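/- **Setting.** Let $g_0,\dots,g_N:\mathbb{R}^D\to\mathbb{R}^D$ ($N\ge 1$), and for $w\in\mathbb{R}^N$ put $G(\theta,w)=\frac1N\big(g_0(\theta)+\sum_{n=1}^N w_n g_n(\theta)\big)$. Let $1_N$ be the all-ones vector, $G^{(k)}(\theta,w)$ the array of $k$-th order partial derivatives of $G$ in $\theta$, and $H=G^{(1)}$; the norm $\|\cdot\|_2$ of an array is the Euclidean norm of its vector of entries. Fix an integer $k_{IJ}\ge 0$, a weight vector $w$ and $\varepsilon>0$, and let $\Omega_w$ be the open $\varepsilon$-neighbourhood (in $\|\cdot\|_2$) of the segment from $1_N$ to $w$. **Assumptions.** 1. (Domain) For each $\tilde w\in\Omega_w$, $\hat\theta(\tilde w)$ is a solution of $G(\theta,\tilde w)=0$ (any choice, with no regularity in $\tilde w$ assumed), and $\Omega_\theta\subseteq\mathbb{R}^D$ is an open set that contains, for some $\eta>0$, the open $\eta$-neighbourhood of the convex hull of $\{\hat\theta(\tilde w):\tilde w\in\Omega_w\}$. 2. (Differentiability) $g_0,\dots,g_N$ are $k_{IJ}+1$ times continuously differentiable on $\Omega_\theta$. 3. (Strong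 convexity) There is $C_{op}>0$ such that $H(\theta,1_N)$ is strongly positive definite with constant $C_{op}$ for all $\theta\in\Omega_\theta$, i.e. $v^\top H(\theta,1_N)v\ge\|v\|_2^2/C_{op}$ for all $v\in\mathbb{R}^D$. (For symmetric $H$ this says that $H(\theta,1_N)$ is positive definite with $\|H(\theta,1_N)^{-1}\|_{op}\le C_{op}$.) 4. (Derivative bounds) $\sup_{\theta\in\Omega_\theta}\|G^{(k)}(\theta,1_N)\|_2\le M_k$ for $1\le k\le k_{IJ}+1$. 5. (Complexity) $\sup_{\tilde w\in\Omega_w}\sup_{\theta\in\Omega_\theta}\|G^{(k)}(\theta,\tilde w)-G^{(k)}(\theta,1_N)\|_2\le\delta_k$ for $0\le k\le k_{IJ}+1$. Put $\delta=\max\{\delta_0,\dots,\delta_{k_{IJ}+1}\}$. 6. (Smallness) $C_{op}\delta_1+C_{op}^2L_H\delta_0\le\rho$ for some $0<\rho<1$ and some $L_H\ge 0$ (for instance a Lipschitz constant of $\theta\mapsto H(\theta,1_N)$, such as $M_2$). Put $\tilde C_{op}=\frac{1}{1-\rho}C_{op}$. Let $d^k\hat\theta(\tilde w)$ be the $k$-th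 order directional derivative of $\hat\theta$ at $\tilde w$ in the direction $w-1_N$, and for $k\le k_{IJ}$ let $$\hat\theta_{IJ}^k(w)=\hat\theta(1_N)+\sum_{j=1}^k\frac1{j!}\,d^j\hat\theta(1_N).$$ **Theorem.** Under assumptions 1–6, with $\tilde C_{op}$ and the $M_k$ fixed as $\delta\to0$, for every $k=0,\dots,k_{IJ}$ $$\sup_{\tilde w\in\Omega_w}\|d^{k+1}\hat\theta(\tilde w)\|_2=O(\delta^{k+1})\qquad\text{and}\qquad\|\hat\theta_{IJ}^k(w)-\hat\theta(w)\|_2=O(\delta^{k+1}).$$ That is, for each $k\le k_{IJ}$ there are constants $K,\delta^*>0$, depending only on $k_{IJ}$, $k$, $\tilde C_{op}$ and the $M_j$, such that whenever assumptions 1–6 hold (for any $N$, $D$, $g_n$, $w$, $\varepsilon$, $\Omega_\theta$, $\hat\theta$, $C_{op}$, $\rho$, $L_H$, $\delta_k$ with these $\tilde C_{op}$ and $M_j$) and $\delta\le\delta^*$, the map $\hat\theta$ is $k_{IJ}+1$ times continuously differentiable on $\Omega_w$ and both quantities are at most $K\delta^{k+1}$. -/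

import Mathlib

namespace HOIJ

noncomputable section

/-- Euclidean space `ℝ^n` (with the 2-norm). -/
abbrev E (n : ℕ) : Type := EuclideanSpace ℝ (Fin n)

/-- The all-ones weight vector. -/
def ones (N : ℕ) : E N := WithLp.toLp 2 (fun _ => (1 : ℝ))

/-- The weighted estimating function
`G(θ, w) = (1 / N) * (g₀(θ) + ∑_{n=1}^N w_n g_n(θ))`.
Here `g 0` is the regularization term and `g n.succ` is the term with weight `w n`. -/
def G {N D : ℕ} (g : Fin (N + 1) → E D → E D) (θ : E D) (w : E N) : E D :=
  (1 / (N : ℝ)) • (g 0 θ + ∑ n : Fin N, w n • g n.succ θ)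

/-- The `D^(k+1)`-array `G^(k)(θ, w)` of `k`-th order partial derivatives of `G(·, w)` at `θ`:
the entry at `d = (d₁, …, d_k)` is the vector `∂^k G(θ, w) / ∂θ_{d₁} ⋯ ∂θ_{d_k}`. -/
def derivArray {N D : ℕ} (g : Fin (N + 1) → E D → E D) (k : ℕ) (θ : E D) (w : E N) :
    (Fin k → Fin D) → E D :=
  fun d => iteratedFDeriv ℝ k (fun ϑ => G g ϑ w) θ
    (fun i => EuclideanSpace.single (d i) (1 : ℝ))

/-- The 2-norm of the vectorization of an array (the root of the sum of the squares of all its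
`D^(k+1)` scalar entries). -/
def arrayNorm {D k : ℕ} (a : (Fin k → Fin D) → E D) : ℝ :=
  Real.sqrt (∑ d, ‖a d‖ ^ 2)

/-- The matrix `H(θ, w) = ∂G(θ, w)/∂θ`, as a linear map. -/
def H {N D : ℕ} (g : Fin (N + 1) → E D → E D) (θ : E D) (w : E N) : E D →L[ℝ] E D :=
  fderiv ℝ (fun ϑ => G g ϑ w) θ

/-- `A` (not necessarily symmetric) is strongly positive definite with constant `C`:
`vᵀ A v ≥ ‖v‖² / C` for all `v`. It implies that `A` is invertible with `‖A⁻¹‖_op ≤ C`, and for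
symmetric `A` it is equivalent to `A` being positive definite with `‖A⁻¹‖_op ≤ C`; see the two
facts below. -/
def StronglyPosDef {D : ℕ} (A : E D →L[ℝ] E D) (C : ℝ) : Prop :=
  0 < C ∧ ∀ v : E D, ‖v‖ ^ 2 ≤ C * inner ℝ v (A v)

theorem StronglyPosDef.exists_inverse {D : ℕ} {A : E D →L[ℝ] E D} {C : ℝ}
    (h : StronglyPosDef A C) :
    ∃ B : E D →L[ℝ] E D, (∀ v, A (B v) = v) ∧ (∀ v, B (A v) = v) ∧ ‖B‖ ≤ C := by
  obtain ⟨hC, h⟩ := h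
  have hb : ∀ v, ‖v‖ ≤ C * ‖A v‖ := by
    intro v
    by_cases hv : ‖v‖ = 0
    · rw [hv]; positivity
    · have hpos : 0 < ‖v‖ := lt_of_le_of_ne (norm_nonneg v) (Ne.symm hv)
      have h1 := real_inner_le_norm v (A v)
      have h2 := h v
      have h3 := mul_le_mul_of_nonneg_left h1 hC.le
      have h4 : ‖v‖ * ‖v‖ ≤ ‖v‖ * (C * ‖A v‖) := by nlinarith
      exact le_of_mul_le_mul_left h4 hpos
  have hinj : Function.Injective (A : E D →ₗ[ℝ] E D) := by
    rw [← LinearMap.ker_eq_bot, LinearMap.ker_eq_bot']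
    intro v hv
    have h1 := hb v
    have h2 : A v = 0 := hv
    rw [h2, norm_zero, mul_zero] at h1
    exact norm_le_zero_iff.mp h1
  let e := LinearEquiv.ofInjectiveEndo (A : E D →ₗ[ℝ] E D) hinj
  have he : ∀ v, e v = A v := fun v => rfl
  refine ⟨LinearMap.toContinuousLinearMap (e.symm : E D →ₗ[ℝ] E D), ?_, ?_, ?_⟩
  · intro v
    have h1 := e.apply_symm_apply v
    rw [he] at h1
    exact h1
  · intro v
    have h1 := e.symm_apply_apply v
    rw [he] at h1
    exact h1
  · refine ContinuousLinearMap.opNorm_le_bound _ hC.le (fun v => ?_)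
    have h1 := hb (e.symm v)
    have h2 := e.apply_symm_apply v
    rw [he] at h2
    rw [h2] at h1
    exact h1

theorem stronglyPosDef_iff_of_symmetric {D : ℕ} {A : E D →L[ℝ] E D} {C : ℝ} (hC : 0 < C)
    (hA : ∀ u v, inner ℝ (A u) v = inner ℝ u (A v)) :
    StronglyPosDef A C ↔
      (∀ v, v ≠ 0 → 0 < inner ℝ v (A v)) ∧
      ∃ B : E D →L[ℝ] E D, (∀ v, A (B v) = v) ∧ (∀ v, B (A v) = v) ∧ ‖B‖ ≤ C := by
  constructor
  · intro h
    refine ⟨fun v hv => ?_, h.exists_inverse⟩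
    have h1 := h.2 v
    have h2 : 0 < ‖v‖ := norm_pos_iff.mpr hv
    by_contra hcon
    have h3 : C * inner ℝ v (A v) ≤ 0 :=
      mul_nonpos_of_nonneg_of_nonpos hC.le (not_lt.mp hcon)
    have h4 : 0 < ‖v‖ ^ 2 := by positivity
    linarith
  · rintro ⟨hpos, B, hAB, -, hB⟩
    refine ⟨hC, fun v => ?_⟩
    have hnn : ∀ x, 0 ≤ inner ℝ x (A x) := by
      intro x
      by_cases hx : x = 0
      · simp [hx]
      · exact (hpos x hx).le
    have h1 := hnn (v - (1 / C) • B v)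
    have h2 : inner ℝ (B v) v ≤ C * ‖v‖ ^ 2 := by
      have h3 := real_inner_le_norm (B v) v
      have h4 := B.le_of_opNorm_le hB v
      nlinarith [norm_nonneg v]
    have h5 : inner ℝ (B v) (A v) = ‖v‖ ^ 2 := by
      rw [← hA, hAB, real_inner_self_eq_norm_sq]
    have h6 : inner ℝ (v - (1 / C) • B v) (A (v - (1 / C) • B v)) =
        inner ℝ v (A v) - 2 * (1 / C) * ‖v‖ ^ 2 + (1 / C) ^ 2 * inner ℝ (B v) v := by
      simp only [map_sub, map_smul, hAB, inner_sub_left, inner_sub_right, inner_smul_left,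
        inner_smul_right, h5, real_inner_self_eq_norm_sq]
      simp
      ring
    rw [h6] at h1
    have h7 : (1 / C) ^ 2 * inner ℝ (B v) v ≤ (1 / C) ^ 2 * (C * ‖v‖ ^ 2) :=
      mul_le_mul_of_nonneg_left h2 (by positivity)
    have h8 : (1 / C) ^ 2 * (C * ‖v‖ ^ 2) = (1 / C) * ‖v‖ ^ 2 := by
      field_simp
    have h9 : (1 / C) * ‖v‖ ^ 2 ≤ inner ℝ v (A v) := by linarith
    calc ‖v‖ ^ 2 = C * ((1 / C) * ‖v‖ ^ 2) := by field_simp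
      _ ≤ C * inner ℝ v (A v) := mul_le_mul_of_nonneg_left h9 hC.le

/-- The open `ε`-neighbourhood `Ω_w` of the segment from the all-ones vector to `w`. -/
def weightDomain {N : ℕ} (w : E N) (ε : ℝ) : Set (E N) :=
  {w' | ∃ t ∈ Set.Icc (0 : ℝ) 1, ‖w' - ((1 - t) • ones N + t • w)‖ < ε}

/-- The `k`-th order directional derivative `d^k θ̂(w')` in the direction `Δw = w - 1`, that is
`∑_{n₁, …, n_k} ∂^k θ̂ / ∂w_{n₁} ⋯ ∂w_{n_k} (w') Δw_{n₁} ⋯ Δw_{n_k}`. -/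
def dTheta {N D : ℕ} (θhat : E N → E D) (w : E N) (k : ℕ) (w' : E N) : E D :=
  iteratedFDeriv ℝ k θhat w' (fun _ => w - ones N)

/-- The `k`-th order infinitesimal jackknife
`θ̂_IJ^k(w) = θ̂(1) + ∑_{j=1}^k (1 / j!) d^j θ̂(1)`. -/
def thetaIJ {N D : ℕ} (θhat : E N → E D) (w : E N) (k : ℕ) : E D :=
  θhat (ones N) + ∑ j ∈ Finset.Icc 1 k, (1 / (j.factorial : ℝ)) • dTheta θhat w j (ones N)

/-- The standing assumptions, for order `κ`, at the weight vector `w`, with `Ωw` the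
`ε`-neighbourhood `weightDomain w ε` and `Ωθ` the domain of `θ`. -/
structure Assumptions {N D : ℕ} (κ : ℕ) (g : Fin (N + 1) → E D → E D) (w : E N) (ε : ℝ)
    (Ωθ : Set (E D)) (θhat : E N → E D) (Cop : ℝ) (M δ : ℕ → ℝ) : Prop where
  eps_pos : 0 < ε
  /-- `θ̂(w')` is a solution of `G(θ, w') = 0`, for each `w' ∈ Ω_w`; any choice of solutions is
  allowed, with no regularity in `w'`. -/
  solution : ∀ w' ∈ weightDomain w ε, G g (θhat w') w' = 0
  isOpen_domain : IsOpen Ωθ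
  /-- The domain contains an enlargement of the convex hull of these solutions. -/
  domain : ∃ η : ℝ, 0 < η ∧
    Metric.thickening η (convexHull ℝ (θhat '' weightDomain w ε)) ⊆ Ωθ
  differentiable : ∀ n, ContDiffOn ℝ ((κ + 1 : ℕ) : WithTop ℕ∞) (g n) Ωθ
  convexity : ∀ θ ∈ Ωθ, StronglyPosDef (H g θ (ones N)) Cop
  bounded : ∀ k, 1 ≤ k → k ≤ κ + 1 → ∀ θ ∈ Ωθ, arrayNorm (derivArray g k θ (ones N)) ≤ M k
  complexity : ∀ k, k ≤ κ + 1 → ∀ w' ∈ weightDomain w ε, ∀ θ ∈ Ωθ,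
    arrayNorm (derivArray g k θ w' - derivArray g k θ (ones N)) ≤ δ k

/-- `δ = max {δ_0, …, δ_{κ+1}}`. -/
def deltaMax (κ : ℕ) (δ : ℕ → ℝ) : ℝ :=
  (Finset.range (κ + 2)).sup' ⟨0, by simp⟩ δ

/-- The constant `C_set = C_op δ_1 + C_op² L_H δ_0`. -/
def Cset (Cop LH : ℝ) (δ : ℕ → ℝ) : ℝ :=
  Cop * δ 1 + Cop ^ 2 * LH * δ 0

end

end HOIJ

/-!
The estimating function `G(θ, w)` is affine in the weights. Along a line `s ↦ w' + s (w - 1)` the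
solutions `f(s) = θ̂(w' + s (w - 1))` therefore satisfy `A(f(s)) + s P(f(s)) = 0` with `A = G(·, w')`
and `P = G(·, w) - G(·, 1)`, where all derivatives of `P` are at most `δ`, those of `A` of order at
least one are bounded by a constant, and `A'` has an inverse of norm at most `C̃_op`.

*Bounds.* The derivative of order `n + 1` of this identity at `s = 0` expresses `A'(f(0)) f^(n+1)(0)`
through lower derivatives of `f` and through `n + 1` times the `n`-th derivative of `P ∘ f`. If
`‖f^(i)(0)‖ ≤ (B δ)^i` for `1 ≤ i ≤ n`, then the `i`-th derivative of a composition `u ∘ f` is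
at most `i! K (B δ)^i`, with `K` a bound for the derivatives of `u` at `f(0)`, and all
terms of the identity are `O((B δ)^(n+1))`; hence the bound passes to order `n + 1` with a larger
`B` (`exists_bound_iteratedFDeriv_of_implicit`). Only operator norms
enter, and these are at most the array norms by Cauchy–Schwarz (`opNorm_le_arrayNorm`), so that `B`
does not depend on the dimensions.

*Regularity.* By the smallness condition, `∂G(θ, w')/∂θ` is strongly positive definite with constant
`C̃_op` for all weights in the domain (`Assumptions.stronglyPosDef`). Since the domain of `θ` contains
the segment between any two solutions, `G(·, w')` is strongly monotone there, which makes `θ̂`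
continuous (`Assumptions.continuousAt`). A continuous solution coincides locally with the implicit
function and so is as smooth as `G` (`contDiffAt_of_implicit`).

The bound for the infinitesimal jackknife follows from the integral form of Taylor's theorem on the
segment from the all-ones vector to `w` (`norm_thetaIJ_sub_le`).
-/

namespace HOIJ

open Filter Topology

/-! ### Pointwise bounds for derivatives of products and compositions -/

section Pointwise

variable {X Y Z : Type*} [NormedAddCommGroup X] [NormedSpace ℝ X]
  [NormedAddCommGroup Y] [NormedSpace ℝ Y] [NormedAddCommGroup Z] [NormedSpace ℝ Z]

theorem exists_isOpen_contDiffOn {n : ℕ} {f : X → Y} {x : X} (hf : ContDiffAt ℝ n f x) :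
    ∃ u, IsOpen u ∧ x ∈ u ∧ ContDiffOn ℝ n f u := by
  obtain ⟨u, hu, hxu, h⟩ := ContDiffWithinAt.contDiffOn' (m := n) le_rfl (by simp) hf
  exact ⟨u, hu, hxu, by simpa using h⟩

theorem norm_iteratedFDeriv_clm_apply_le {n : ℕ} {L : X → Y →L[ℝ] Z} {g : X → Y} {x : X}
    (hL : ContDiffAt ℝ n L x) (hg : ContDiffAt ℝ n g x) :
    ‖iteratedFDeriv ℝ n (fun y => L y (g y)) x‖ ≤ ∑ i ∈ Finset.range (n + 1),
      (n.choose i : ℝ) * ‖iteratedFDeriv ℝ i L x‖ * ‖iteratedFDeriv ℝ (n - i) g x‖ := by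
  obtain ⟨u, hu, hxu, hLu⟩ := exists_isOpen_contDiffOn hL
  obtain ⟨v, hv, hxv, hgv⟩ := exists_isOpen_contDiffOn hg
  have ho := hu.inter hv
  have hx : x ∈ u ∩ v := ⟨hxu, hxv⟩
  have h := norm_iteratedFDerivWithin_clm_apply (hLu.mono Set.inter_subset_left)
    (hgv.mono Set.inter_subset_right) ho.uniqueDiffOn hx le_rfl
  simpa only [iteratedFDerivWithin_of_isOpen _ ho hx] using h

theorem norm_iteratedFDeriv_smul_fun_le {n : ℕ} {c : X → ℝ} {g : X → Y} {x : X}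
    (hc : ContDiffAt ℝ n c x) (hg : ContDiffAt ℝ n g x) :
    ‖iteratedFDeriv ℝ n (fun y => c y • g y) x‖ ≤ ∑ i ∈ Finset.range (n + 1),
      (n.choose i : ℝ) * ‖iteratedFDeriv ℝ i c x‖ * ‖iteratedFDeriv ℝ (n - i) g x‖ := by
  obtain ⟨u, hu, hxu, hcu⟩ := exists_isOpen_contDiffOn hc
  obtain ⟨v, hv, hxv, hgv⟩ := exists_isOpen_contDiffOn hg
  have ho := hu.inter hv
  have hx : x ∈ u ∩ v := ⟨hxu, hxv⟩
  have h := norm_iteratedFDerivWithin_smul_le (hcu.mono Set.inter_subset_left)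
    (hgv.mono Set.inter_subset_right) ho.uniqueDiffOn hx le_rfl
  simpa only [iteratedFDerivWithin_of_isOpen _ ho hx] using h

theorem norm_iteratedFDeriv_comp_le_of_contDiffAt {n : ℕ} {g : Y → Z} {f : X → Y} {x : X}
    (hg : ContDiffAt ℝ n g (f x)) (hf : ContDiffAt ℝ n f x) {C D : ℝ}
    (hC : ∀ i, i ≤ n → ‖iteratedFDeriv ℝ i g (f x)‖ ≤ C)
    (hD : ∀ i, 1 ≤ i → i ≤ n → ‖iteratedFDeriv ℝ i f x‖ ≤ D ^ i) :
    ‖iteratedFDeriv ℝ n (fun y => g (f y)) x‖ ≤ n.factorial * C * D ^ n := by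
  obtain ⟨u, hu, hxu, hgu⟩ := exists_isOpen_contDiffOn hg
  obtain ⟨v, hv, hxv, hfv⟩ := exists_isOpen_contDiffOn hf
  have ho : IsOpen (v ∩ f ⁻¹' u) := hfv.continuousOn.isOpen_inter_preimage hv hu
  have hx : x ∈ v ∩ f ⁻¹' u := ⟨hxv, hxu⟩
  have h := norm_iteratedFDerivWithin_comp_le hgu (hfv.mono Set.inter_subset_left) le_rfl
    hu.uniqueDiffOn ho.uniqueDiffOn (fun y hy => hy.2) hx (C := C) (D := D)
    (fun i hi => by rw [iteratedFDerivWithin_of_isOpen _ hu hxu]; exact hC i hi)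
    (fun i h1 hi => by rw [iteratedFDerivWithin_of_isOpen _ ho hx]; exact hD i h1 hi)
  rwa [iteratedFDerivWithin_of_isOpen _ ho hx] at h

/-- The iterated derivatives along a line are the iterated directional derivatives. -/
theorem iteratedDeriv_comp_line {n : ℕ} {f : X → Y} (x v : X) (s : ℝ)
    (hf : ContDiffAt ℝ n f (x + s • v)) :
    iteratedDeriv n (fun t : ℝ => f (x + t • v)) s
      = iteratedFDeriv ℝ n f (x + s • v) (fun _ => v) := by
  obtain ⟨u, hu, hxu, hfu⟩ := exists_isOpen_contDiffOn hf
  let ℓ : ℝ →L[ℝ] X := ContinuousLinearMap.toSpanSingleton ℝ v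
  have hu' : IsOpen ((fun z => x + z) ⁻¹' u) := hu.preimage (by fun_prop)
  have hs : ℓ s ∈ (fun z => x + z) ⁻¹' u := by simpa [ℓ] using hxu
  have hg : ContDiffOn ℝ n (fun z => f (x + z)) ((fun z => x + z) ⁻¹' u) :=
    hfu.comp (by fun_prop) (fun _ h => h)
  have ho : IsOpen (ℓ ⁻¹' ((fun z => x + z) ⁻¹' u)) := hu'.preimage ℓ.continuous
  have h := ℓ.iteratedFDerivWithin_comp_right hg hu'.uniqueDiffOn ho.uniqueDiffOn hs le_rfl
  rw [iteratedFDerivWithin_of_isOpen _ ho hs, iteratedFDerivWithin_of_isOpen _ hu' hs,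
    iteratedFDeriv_comp_add_left] at h
  have h' := congrArg (fun T => T (fun _ => (1 : ℝ))) h
  simpa [ℓ, iteratedDeriv_eq_iteratedFDeriv, Function.comp_def] using h'

end Pointwise

/-! ### Derivative bounds for implicitly defined curves -/

/-- Differentiating `s • u s` at `0` gains a factor `n + 1` and loses one derivative. -/
theorem norm_iteratedFDeriv_id_smul_le {X : Type*} [NormedAddCommGroup X] [NormedSpace ℝ X]
    {n : ℕ} {u : ℝ → X} (hu : ContDiffAt ℝ ((n + 1 : ℕ) : WithTop ℕ∞) u 0) :
    ‖iteratedFDeriv ℝ (n + 1) (fun s : ℝ => s • u s) 0‖ ≤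
      (n + 1) * ‖iteratedFDeriv ℝ n u 0‖ := by
  refine (norm_iteratedFDeriv_smul_fun_le (c := fun s : ℝ => s) contDiffAt_id hu).trans ?_
  rw [Finset.sum_eq_single 1]
  · have h1 : ‖iteratedFDeriv ℝ 1 (fun s : ℝ => s) 0‖ = 1 := by
      rw [norm_iteratedFDeriv_eq_norm_iteratedDeriv, iteratedDeriv_one]
      simp
    rw [h1]
    simp
  · intro i _ hi
    have h0 : ‖iteratedFDeriv ℝ i (fun s : ℝ => s) 0‖ = 0 := by
      rw [norm_iteratedFDeriv_eq_norm_iteratedDeriv]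
      match i, hi with
      | 0, _ => simp
      | j + 2, _ =>
        rw [iteratedDeriv_succ', iteratedDeriv_succ']
        simp
    simp [h0]
  · intro h
    simp at h

/-- The top-order derivative of a composition: up to a remainder that involves only lower
derivatives of `f`, it is the differential of `A` applied to the derivative of `f`. -/
theorem norm_fderiv_iteratedDeriv_succ_le {X Y : Type*} [NormedAddCommGroup X] [NormedSpace ℝ X]
    [NormedAddCommGroup Y] [NormedSpace ℝ Y] {n : ℕ} {A : X → Y} {f : ℝ → X} {C r : ℝ}
    (hA : ContDiffAt ℝ ((n + 1 : ℕ) : WithTop ℕ∞) A (f 0))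
    (hf : ContDiffAt ℝ ((n + 1 : ℕ) : WithTop ℕ∞) f 0) (hC : 0 ≤ C) (hr : 0 ≤ r)
    (hAC : ∀ i, 1 ≤ i → i ≤ n + 1 → ‖iteratedFDeriv ℝ i A (f 0)‖ ≤ C)
    (hfr : ∀ i, 1 ≤ i → i ≤ n → ‖iteratedFDeriv ℝ i f 0‖ ≤ r ^ i) :
    ‖fderiv ℝ A (f 0) (iteratedDeriv (n + 1) f 0)‖ ≤
      ‖iteratedFDeriv ℝ (n + 1) (fun s => A (f s)) 0‖ +
        (∑ i ∈ Finset.range (n + 1), (n.choose i : ℝ) * i.factorial) * C * r ^ (n + 1) := by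
  set T := fderiv ℝ A (f 0) with hT
  have hA' : ContDiffAt ℝ n (fderiv ℝ A) (f 0) := hA.fderiv_right (by simp)
  have hf' : ContDiffAt ℝ n (deriv f) 0 := hf.derivWithin (by simp)
  have hA'f : ContDiffAt ℝ n (fun s => fderiv ℝ A (f s)) 0 :=
    hA'.comp 0 (hf.of_le (by exact_mod_cast n.le_succ))
  have hR : ContDiffAt ℝ n (fun s => T - fderiv ℝ A (f s)) 0 := contDiffAt_const.sub hA'f
  have hAf : ContDiffAt ℝ n (fun s => fderiv ℝ A (f s) (deriv f s)) 0 := hA'f.clm_apply hf'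
  have hRf : ContDiffAt ℝ n (fun s => (T - fderiv ℝ A (f s)) (deriv f s)) 0 := hR.clm_apply hf'
  have hne : ((n + 1 : ℕ) : WithTop ℕ∞) ≠ 0 := by exact_mod_cast n.succ_ne_zero
  have hchain : deriv (fun s => A (f s)) =ᶠ[𝓝 0] fun s => fderiv ℝ A (f s) (deriv f s) := by
    have hA1 := hf.continuousAt.eventually (hA.eventually (by simp))
    filter_upwards [hA1, hf.eventually (by simp)] with s h1 h2
    exact fderiv_comp_deriv s (h1.differentiableAt hne) (h2.differentiableAt hne)
  have hsplit : T (iteratedDeriv (n + 1) f 0) = iteratedDeriv (n + 1) (fun s => A (f s)) 0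
      + iteratedDeriv n (fun s => (T - fderiv ℝ A (f s)) (deriv f s)) 0 := by
    rw [iteratedDeriv_succ', iteratedDeriv_succ', hchain.iteratedDeriv_eq,
      ← iteratedDeriv_fun_add hAf hRf]
    simp only [sub_apply, add_sub_cancel]
    have h := T.iteratedFDeriv_comp_left hf' le_rfl
    simp only [iteratedDeriv_eq_iteratedFDeriv]
    change _ = iteratedFDeriv ℝ n (T ∘ deriv f) 0 _
    rw [h]
    rfl
  have hrem : ‖iteratedFDeriv ℝ n (fun s => (T - fderiv ℝ A (f s)) (deriv f s)) 0‖ ≤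
      (∑ i ∈ Finset.range (n + 1), (n.choose i : ℝ) * i.factorial) * C * r ^ (n + 1) := by
    refine (norm_iteratedFDeriv_clm_apply_le hR hf').trans ?_
    rw [Finset.sum_mul, Finset.sum_mul]
    refine Finset.sum_le_sum fun i hi => ?_
    have hin : i ≤ n := Nat.lt_succ_iff.mp (Finset.mem_range.mp hi)
    rcases Nat.eq_zero_or_pos i with rfl | hi0
    · -- the factor of order zero vanishes at `0`: this removes the top derivative of `f`
      have : ‖iteratedFDeriv ℝ 0 (fun s => T - fderiv ℝ A (f s)) 0‖ = 0 := by simp [hT]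
      rw [this]
      simp only [mul_zero, zero_mul]
      positivity
    · have hin' : (i : WithTop ℕ∞) ≤ n := by exact_mod_cast hin
      have h1 : ‖iteratedFDeriv ℝ i (fun s => T - fderiv ℝ A (f s)) 0‖
          ≤ i.factorial * C * r ^ i := by
        have he : ‖iteratedFDeriv ℝ i (fun s => T - fderiv ℝ A (f s)) 0‖ =
            ‖iteratedFDeriv ℝ i (fun s => fderiv ℝ A (f s)) 0‖ := by
          change ‖iteratedFDeriv ℝ i ((fun _ => T) - fun s => fderiv ℝ A (f s)) 0‖ = _
          rw [iteratedFDeriv_sub_apply contDiffAt_const (hA'f.of_le hin'),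
            iteratedFDeriv_const_of_ne hi0.ne']
          simp
        rw [he]
        refine norm_iteratedFDeriv_comp_le_of_contDiffAt (hA'.of_le hin')
          (hf.of_le (by exact_mod_cast hin.trans n.le_succ)) (fun j hj => ?_)
          (fun j h1 hj => hfr j h1 (hj.trans hin))
        rw [norm_iteratedFDeriv_fderiv]
        exact hAC _ (by omega) (by omega)
      have h2 : ‖iteratedFDeriv ℝ (n - i) (deriv f) 0‖ ≤ r ^ (n - i + 1) := by
        rw [norm_iteratedFDeriv_eq_norm_iteratedDeriv, ← iteratedDeriv_succ',
          ← norm_iteratedFDeriv_eq_norm_iteratedDeriv]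
        exact hfr _ (by omega) (by omega)
      calc (n.choose i : ℝ) * ‖iteratedFDeriv ℝ i (fun s => T - fderiv ℝ A (f s)) 0‖ *
            ‖iteratedFDeriv ℝ (n - i) (deriv f) 0‖
          ≤ (n.choose i : ℝ) * (i.factorial * C * r ^ i) * r ^ (n - i + 1) := by gcongr
        _ = (n.choose i : ℝ) * i.factorial * C * r ^ (n + 1) := by
          rw [show n + 1 = i + (n - i + 1) by omega, pow_add]
          ring
  rw [hsplit]
  refine (norm_add_le _ _).trans ?_
  rw [norm_iteratedFDeriv_eq_norm_iteratedDeriv] at hrem ⊢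
  exact add_le_add_right hrem _

/-- Let `f` be a curve of zeros of `A + s P`, where `‖v‖ ≤ c ‖A' v‖`, the derivatives of `A` at
`f 0` of order at least one are at most `C` and those of `P` at most `δ`. Then the `i`-th derivative
of `f` at `0` is at most `(B δ) ^ i`, for `i ≥ 1`, with `B` depending only on the order,
`c` and `C`: it does not depend on the space. The geometric form `(B δ) ^ i` is the one that is stable under composition. -/
theorem exists_bound_iteratedFDeriv_of_implicit {c C : ℝ} (hc : 0 ≤ c) (hC : 0 ≤ C) (n : ℕ) :
    ∃ B : ℝ, 1 ≤ B ∧ ∀ (X : Type) [NormedAddCommGroup X] [NormedSpace ℝ X] (A P : X → X)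
      (f : ℝ → X) (δ : ℝ), 0 ≤ δ →
      ContDiffAt ℝ n A (f 0) → ContDiffAt ℝ n P (f 0) → ContDiffAt ℝ n f 0 →
      (∀ᶠ s in 𝓝 (0 : ℝ), A (f s) + s • P (f s) = 0) →
      (∀ v, ‖v‖ ≤ c * ‖fderiv ℝ A (f 0) v‖) →
      (∀ i, 1 ≤ i → i ≤ n → ‖iteratedFDeriv ℝ i A (f 0)‖ ≤ C) →
      (∀ i, i ≤ n → ‖iteratedFDeriv ℝ i P (f 0)‖ ≤ δ) →
      ∀ i, 1 ≤ i → i ≤ n → ‖iteratedFDeriv ℝ i f 0‖ ≤ (B * δ) ^ i := by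
  induction n with
  | zero => exact ⟨1, le_rfl, fun _ _ _ _ _ _ _ _ _ _ _ _ _ _ _ i h1 h0 => by omega⟩
  | succ n ih =>
    obtain ⟨B, hB, ih⟩ := ih
    set S : ℝ := ∑ i ∈ Finset.range (n + 1), (n.choose i : ℝ) * i.factorial with hS
    set Q : ℝ := c * ((n + 1) * n.factorial + S * C) with hQ
    refine ⟨B * max 1 Q, ?_, ?_⟩
    · nlinarith [le_max_left 1 Q]
    intro X _ _ A P f δ hδ hA hP hf h0 hT hAC hPδ i hi1 hi
    have hle : (n : WithTop ℕ∞) ≤ ((n + 1 : ℕ) : WithTop ℕ∞) := by exact_mod_cast n.le_succ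
    have hlow := ih X A P f δ hδ (hA.of_le hle) (hP.of_le hle) (hf.of_le hle) h0 hT
      (fun j h1 hj => hAC j h1 (hj.trans n.le_succ)) (fun j hj => hPδ j (hj.trans n.le_succ))
    have hBδ : 0 ≤ B * δ := by positivity
    have hm : (1 : ℝ) ≤ max 1 Q := le_max_left _ _
    rcases Nat.lt_or_ge n i with hlt | hge
    · obtain rfl : i = n + 1 := by omega
      have hPf : ContDiffAt ℝ ((n + 1 : ℕ) : WithTop ℕ∞) (fun s => P (f s)) 0 := hP.comp 0 hf
      have hAf : ‖iteratedFDeriv ℝ (n + 1) (fun s => A (f s)) 0‖ ≤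
          (n + 1) * (n.factorial * δ * (B * δ) ^ n) := by
        have he : (fun s => A (f s)) =ᶠ[𝓝 0] fun s => -(s • P (f s)) := by
          filter_upwards [h0] with s hs using eq_neg_of_add_eq_zero_left hs
        rw [(he.iteratedFDeriv ℝ (n + 1)).eq_of_nhds]
        change ‖iteratedFDeriv ℝ (n + 1) (-fun s => s • P (f s)) 0‖ ≤ _
        rw [iteratedFDeriv_neg_apply, norm_neg]
        refine (norm_iteratedFDeriv_id_smul_le hPf).trans ?_
        gcongr
        exact norm_iteratedFDeriv_comp_le_of_contDiffAt (hP.of_le hle) (hf.of_le hle)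
          (fun j hj => hPδ j (hj.trans n.le_succ)) hlow
      have hmain := norm_fderiv_iteratedDeriv_succ_le hA hf hC hBδ hAC hlow
      have h1 : δ * (B * δ) ^ n ≤ (B * δ) ^ (n + 1) := by
        rw [pow_succ']
        gcongr
        nlinarith
      rw [norm_iteratedFDeriv_eq_norm_iteratedDeriv]
      calc ‖iteratedDeriv (n + 1) f 0‖
          ≤ c * ‖fderiv ℝ A (f 0) (iteratedDeriv (n + 1) f 0)‖ := hT _
        _ ≤ c * ((n + 1) * (n.factorial * δ * (B * δ) ^ n) + S * C * (B * δ) ^ (n + 1)) := by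
          gcongr
          exact hmain.trans (by gcongr)
        _ = c * ((n + 1) * n.factorial * (δ * (B * δ) ^ n) + S * C * (B * δ) ^ (n + 1)) := by ring
        _ ≤ c * ((n + 1) * n.factorial * (B * δ) ^ (n + 1) + S * C * (B * δ) ^ (n + 1)) := by
          gcongr
        _ = Q * (B * δ) ^ (n + 1) := by rw [hQ]; ring
        _ ≤ (max 1 Q) ^ (n + 1) * (B * δ) ^ (n + 1) := by
          gcongr
          exact (le_max_right 1 Q).trans (le_self_pow₀ hm n.succ_ne_zero)
        _ = (B * max 1 Q * δ) ^ (n + 1) := by rw [← mul_pow]; ring_nf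
    · refine (hlow i hi1 hge).trans ?_
      gcongr
      nlinarith

/-! ### Regularity of a continuous solution of an implicit equation -/

/-- A continuous solution of `Φ (w, θ w) = 0` inherits the smoothness of `Φ` where the partial
differential in the second variable is invertible: it agrees locally with the implicit function. -/
theorem contDiffAt_of_implicit {W X : Type*} [NormedAddCommGroup W] [NormedSpace ℝ W]
    [CompleteSpace W] [NormedAddCommGroup X] [NormedSpace ℝ X] [CompleteSpace X] {n : ℕ}
    (hn : n ≠ 0) {Φ : W × X → X} {θ : W → X} {w : W}
    (hΦ : ContDiffAt ℝ n Φ (w, θ w)) (hθ : ContinuousAt θ w)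
    (h0 : ∀ᶠ w' in 𝓝 w, Φ (w', θ w') = 0)
    (hinv : (fderiv ℝ (fun x => Φ (w, x)) (θ w)).IsInvertible) : ContDiffAt ℝ n θ w := by
  have hn' : (n : WithTop ℕ∞) ≠ 0 := by exact_mod_cast hn
  have hpart : fderiv ℝ Φ (w, θ w) ∘L .inr ℝ W X = fderiv ℝ (fun x => Φ (w, x)) (θ w) := by
    have h := (hΦ.differentiableAt hn').hasFDerivAt.comp (θ w) (hasFDerivAt_prodMk_right w (θ w))
    exact h.fderiv.symm
  have hinv' : (fderiv ℝ Φ (w, θ w) ∘L .inr ℝ W X).IsInvertible := hpart ▸ hinv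
  have hev := hΦ.eventually_apply_eq_iff_implicitFunction hn' hinv'
  have hcont : Tendsto (fun w' => (w', θ w')) (𝓝 w) (𝓝 (w, θ w)) :=
    (continuousAt_id.prodMk hθ)
  refine (hΦ.contDiffAt_implicitFunction hn' hinv').congr_of_eventuallyEq ?_
  filter_upwards [hcont.eventually hev, h0] with w' h1 h2
  exact (h1.1 (h2.trans h0.self_of_nhds.symm)).symm

/-! ### Operator norms and array norms -/

/-- The operator norm of a multilinear map is at most the Euclidean norm of its array of entries,
by the Cauchy–Schwarz inequality. No dimensional constant appears. -/
theorem opNorm_le_arrayNorm {D k : ℕ}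
    (T : ContinuousMultilinearMap ℝ (fun _ : Fin k => E D) (E D)) :
    ‖T‖ ≤ arrayNorm (fun d => T (fun i => EuclideanSpace.single (d i) (1 : ℝ))) := by
  refine T.opNorm_le_bound (Real.sqrt_nonneg _) fun m => ?_
  have hexp : T m = ∑ d : Fin k → Fin D, (∏ i, m i (d i)) •
      T (fun i => EuclideanSpace.single (d i) (1 : ℝ)) := by
    have hm : m = fun i => ∑ j, m i j • EuclideanSpace.single j (1 : ℝ) := by
      funext i
      conv_lhs => rw [← (EuclideanSpace.basisFun (Fin D) ℝ).sum_repr (m i)]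
      simp
    conv_lhs => rw [hm]
    rw [ContinuousMultilinearMap.map_sum]
    simp_rw [ContinuousMultilinearMap.map_smul_univ]
  have hprod : ∏ i, ‖m i‖ = Real.sqrt (∑ d : Fin k → Fin D, (∏ i, |m i (d i)|) ^ 2) := by
    simp_rw [EuclideanSpace.norm_eq]
    rw [← Real.sqrt_prod _ (fun i _ => by positivity), Finset.prod_univ_sum]
    simp [← Finset.abs_prod, Finset.prod_pow, Fintype.piFinset_univ]
  rw [hexp, hprod, mul_comm]
  refine (norm_sum_le _ _).trans ?_
  refine le_trans (le_of_eq ?_) (Real.sum_mul_le_sqrt_mul_sqrt Finset.univ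
    (fun d : Fin k → Fin D => ∏ i, |m i (d i)|) _)
  refine Finset.sum_congr rfl fun d _ => ?_
  rw [norm_smul, Real.norm_eq_abs, Finset.abs_prod]

theorem norm_iteratedFDeriv_G_le {N D : ℕ} (g : Fin (N + 1) → E D → E D) (k : ℕ) (θ : E D)
    (w : E N) : ‖iteratedFDeriv ℝ k (fun ϑ => G g ϑ w) θ‖ ≤ arrayNorm (derivArray g k θ w) :=
  opNorm_le_arrayNorm _

theorem norm_iteratedFDeriv_G_sub_le {N D : ℕ} (g : Fin (N + 1) → E D → E D) (k : ℕ) (θ : E D)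
    (w w' : E N) :
    ‖iteratedFDeriv ℝ k (fun ϑ => G g ϑ w) θ - iteratedFDeriv ℝ k (fun ϑ => G g ϑ w') θ‖ ≤
      arrayNorm (derivArray g k θ w - derivArray g k θ w') :=
  opNorm_le_arrayNorm _

/-! ### The estimating function and the weight domain -/

theorem G_add_smul_sub {N D : ℕ} (g : Fin (N + 1) → E D → E D) (θ : E D) (a b c : E N) (s : ℝ) :
    G g θ (a + s • (b - c)) = G g θ a + s • (G g θ b - G g θ c) := by
  have h : ∑ n : Fin N, (a + s • (b - c)) n • g n.succ θ = ∑ n : Fin N, a n • g n.succ θ +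
      s • (∑ n : Fin N, b n • g n.succ θ - ∑ n : Fin N, c n • g n.succ θ) := by
    rw [← Finset.sum_sub_distrib, Finset.smul_sum, ← Finset.sum_add_distrib]
    refine Finset.sum_congr rfl fun n _ => ?_
    simp only [PiLp.add_apply, PiLp.smul_apply, PiLp.sub_apply, smul_eq_mul]
    module
  simp only [G, h]
  module

theorem contDiffAt_G_uncurry {N D n : ℕ} {g : Fin (N + 1) → E D → E D} {θ : E D} (w : E N)
    (hg : ∀ i, ContDiffAt ℝ n (g i) θ) :
    ContDiffAt ℝ n (fun p : E N × E D => G g p.2 p.1) (w, θ) := by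
  have hgi : ∀ i, ContDiffAt ℝ n (fun p : E N × E D => g i p.2) (w, θ) := fun i =>
    ContDiffAt.comp (w, θ) (hg i) contDiffAt_snd
  have hw : ∀ i : Fin N, ContDiffAt ℝ n (fun p : E N × E D => p.1 i) (w, θ) := fun i =>
    ((EuclideanSpace.proj i : E N →L[ℝ] ℝ).contDiff.comp contDiff_fst).contDiffAt
  exact (contDiffAt_const (c := 1 / (N : ℝ))).smul
    ((hgi 0).add (ContDiffAt.sum fun i _ => (hw i).smul (hgi i.succ)))

theorem contDiffAt_G {N D n : ℕ} {g : Fin (N + 1) → E D → E D} {θ : E D} (w : E N)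
    (hg : ∀ i, ContDiffAt ℝ n (g i) θ) : ContDiffAt ℝ n (fun ϑ => G g ϑ w) θ :=
  (contDiffAt_G_uncurry w hg).comp θ (contDiffAt_const.prodMk contDiffAt_id)

theorem continuous_G_weight {N D : ℕ} (g : Fin (N + 1) → E D → E D) (θ : E D) :
    Continuous (fun w => G g θ w) := by
  have hw : ∀ i : Fin N, Continuous (fun w : E N => w i) := fun i =>
    (EuclideanSpace.proj i : E N →L[ℝ] ℝ).continuous
  unfold G
  fun_prop

theorem isOpen_weightDomain {N : ℕ} (w : E N) (ε : ℝ) : IsOpen (weightDomain w ε) := by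
  have h : weightDomain w ε =
      ⋃ t ∈ Set.Icc (0 : ℝ) 1, Metric.ball ((1 - t) • ones N + t • w) ε := by
    ext w'
    simp [weightDomain, dist_eq_norm]
  rw [h]
  exact isOpen_biUnion fun _ _ => Metric.isOpen_ball

theorem segment_mem_weightDomain {N : ℕ} (w : E N) {ε : ℝ} (hε : 0 < ε) {t : ℝ}
    (ht : t ∈ Set.Icc (0 : ℝ) 1) : ones N + t • (w - ones N) ∈ weightDomain w ε := by
  refine ⟨t, ht, ?_⟩
  have h : ones N + t • (w - ones N) - ((1 - t) • ones N + t • w) = 0 := by module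
  rw [h, norm_zero]
  exact hε

theorem ones_mem_weightDomain {N : ℕ} (w : E N) {ε : ℝ} (hε : 0 < ε) :
    ones N ∈ weightDomain w ε := by
  simpa using segment_mem_weightDomain w hε (t := 0) (by simp)

theorem mem_weightDomain_self {N : ℕ} (w : E N) {ε : ℝ} (hε : 0 < ε) : w ∈ weightDomain w ε := by
  simpa using segment_mem_weightDomain w hε (t := 1) (by simp)

/-! ### Strong monotonicity and the solution map -/

theorem StronglyPosDef.norm_le {D : ℕ} {A : E D →L[ℝ] E D} {C : ℝ} (h : StronglyPosDef A C)
    (v : E D) : ‖v‖ ≤ C * ‖A v‖ := by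
  obtain ⟨B, -, hB, hBC⟩ := h.exists_inverse
  calc ‖v‖ = ‖B (A v)‖ := by rw [hB]
    _ ≤ C * ‖A v‖ := B.le_of_opNorm_le hBC _

theorem StronglyPosDef.isInvertible {D : ℕ} {A : E D →L[ℝ] E D} {C : ℝ}
    (h : StronglyPosDef A C) : A.IsInvertible := by
  obtain ⟨B, hAB, hBA, -⟩ := h.exists_inverse
  exact ⟨ContinuousLinearEquiv.equivOfInverse A B hBA hAB, rfl⟩

/-- Strong positive definiteness survives a perturbation that is small relative to `1 / C`. -/
theorem StronglyPosDef.of_norm_sub_le {D : ℕ} {A A' : E D →L[ℝ] E D} {C d ρ : ℝ}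
    (h : StronglyPosDef A C) (hd : ∀ v, ‖A' v - A v‖ ≤ d * ‖v‖) (hρ : C * d ≤ ρ) (hρ1 : ρ < 1) :
    StronglyPosDef A' (1 / (1 - ρ) * C) := by
  obtain ⟨hC, h⟩ := h
  have hpos : 0 < 1 - ρ := by linarith
  refine ⟨by positivity, fun v => ?_⟩
  have h1 := h v
  have h2 : inner ℝ v (A v) ≤ inner ℝ v (A' v) + d * ‖v‖ ^ 2 := by
    have h3 : inner ℝ v (A v) = inner ℝ v (A' v) + inner ℝ v (A v - A' v) := by
      rw [← inner_add_right]
      congr 1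
      abel
    have h4 := real_inner_le_norm v (A v - A' v)
    rw [norm_sub_rev] at h4
    have h5 := mul_le_mul_of_nonneg_left (hd v) (norm_nonneg v)
    rw [h3]
    linarith
  have h6 : (1 - ρ) * ‖v‖ ^ 2 ≤ C * inner ℝ v (A' v) := by
    nlinarith [mul_le_mul_of_nonneg_left h2 hC.le, mul_le_mul_of_nonneg_right hρ (sq_nonneg ‖v‖)]
  calc ‖v‖ ^ 2 = 1 / (1 - ρ) * ((1 - ρ) * ‖v‖ ^ 2) := by field_simp
    _ ≤ 1 / (1 - ρ) * (C * inner ℝ v (A' v)) := by gcongr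
    _ = 1 / (1 - ρ) * C * inner ℝ v (A' v) := by ring

/-- A map with strongly positive definite derivative along a segment is strongly monotone between
its end points. -/
theorem norm_sub_sq_le_of_stronglyPosDef {D : ℕ} {F : E D → E D} {C : ℝ} {x y : E D}
    (hF : ∀ z ∈ segment ℝ x y, DifferentiableAt ℝ F z)
    (hpd : ∀ z ∈ segment ℝ x y, StronglyPosDef (fderiv ℝ F z) C) :
    ‖y - x‖ ^ 2 ≤ C * inner ℝ (y - x) (F y - F x) := by
  have hseg : ∀ t ∈ Set.Icc (0 : ℝ) 1, x + t • (y - x) ∈ segment ℝ x y := fun t ht => by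
    rw [segment_eq_image']
    exact ⟨t, ht, rfl⟩
  have hder : ∀ t ∈ Set.Icc (0 : ℝ) 1,
      HasDerivAt (fun t : ℝ => inner ℝ (y - x) (F (x + t • (y - x))))
        (inner ℝ (y - x) (fderiv ℝ F (x + t • (y - x)) (y - x))) t := by
    intro t ht
    have hl : HasDerivAt (fun t : ℝ => x + t • (y - x)) (y - x) t := by
      simpa using ((hasDerivAt_id t).smul_const (y - x)).const_add x
    have hc := (hF _ (hseg t ht)).hasFDerivAt.comp_hasDerivAt t hl
    simpa using (hasDerivAt_const t (y - x)).inner ℝ hc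
  obtain ⟨t, ht, hslope⟩ := exists_hasDerivAt_eq_slope _ _ zero_lt_one
    (fun t ht => (hder t ht).continuousAt.continuousWithinAt)
    (fun t ht => hder t (Set.Ioo_subset_Icc_self ht))
  have h := (hpd _ (hseg t (Set.Ioo_subset_Icc_self ht))).2 (y - x)
  rw [hslope] at h
  simpa [inner_sub_right] using h

section Solution

variable {N D κ : ℕ} {g : Fin (N + 1) → E D → E D} {w : E N} {ε : ℝ} {Ωθ : Set (E D)}
  {θhat : E N → E D} {Cop ρ LH : ℝ} {M δ : ℕ → ℝ}

theorem Assumptions.convexHull_subset (h : Assumptions κ g w ε Ωθ θhat Cop M δ) :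
    convexHull ℝ (θhat '' weightDomain w ε) ⊆ Ωθ := by
  obtain ⟨η, hη, hsub⟩ := h.domain
  exact (Metric.self_subset_thickening hη _).trans hsub

theorem Assumptions.solution_mem (h : Assumptions κ g w ε Ωθ θhat Cop M δ) {w' : E N}
    (hw' : w' ∈ weightDomain w ε) : θhat w' ∈ Ωθ :=
  h.convexHull_subset (subset_convexHull ℝ _ ⟨w', hw', rfl⟩)

theorem Assumptions.contDiffAt (h : Assumptions κ g w ε Ωθ θhat Cop M δ) {θ : E D} (hθ : θ ∈ Ωθ)
    (i : Fin (N + 1)) : ContDiffAt ℝ ((κ + 1 : ℕ) : WithTop ℕ∞) (g i) θ :=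
  (h.differentiable i).contDiffAt (h.isOpen_domain.mem_nhds hθ)

theorem Assumptions.delta_nonneg (h : Assumptions κ g w ε Ωθ θhat Cop M δ) {k : ℕ}
    (hk : k ≤ κ + 1) : 0 ≤ δ k :=
  (Real.sqrt_nonneg _).trans (h.complexity k hk _ (ones_mem_weightDomain w h.eps_pos) _
    (h.solution_mem (ones_mem_weightDomain w h.eps_pos)))

theorem Assumptions.stronglyPosDef (h : Assumptions κ g w ε Ωθ θhat Cop M δ) (hρ : ρ < 1)
    (hLH : 0 ≤ LH) (hset : Cset Cop LH δ ≤ ρ) {w' : E N} (hw' : w' ∈ weightDomain w ε) {θ : E D}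
    (hθ : θ ∈ Ωθ) : StronglyPosDef (fderiv ℝ (fun ϑ => G g ϑ w') θ) (1 / (1 - ρ) * Cop) := by
  refine (h.convexity θ hθ).of_norm_sub_le (d := δ 1) (fun v => ?_) ?_ hρ
  · have h1 := (norm_iteratedFDeriv_G_sub_le g 1 θ w' (ones N)).trans
      (h.complexity 1 (by omega) w' hw' θ hθ)
    have h2 := ContinuousMultilinearMap.le_of_opNorm_le (m := fun _ => v) h1
    simpa [H, iteratedFDeriv_one_apply] using h2
  · have h0 : 0 ≤ Cop ^ 2 * LH * δ 0 :=
      mul_nonneg (mul_nonneg (sq_nonneg _) hLH) (h.delta_nonneg (by omega))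
    unfold Cset at hset
    linarith

/-- Solutions depend continuously on the weights: by strong monotonicity, two solutions differ by
at most a constant times the residual of one of them in the equation of the other. -/
theorem Assumptions.continuousAt (h : Assumptions κ g w ε Ωθ θhat Cop M δ) (hρ : ρ < 1)
    (hLH : 0 ≤ LH) (hset : Cset Cop LH δ ≤ ρ) {w' : E N} (hw' : w' ∈ weightDomain w ε) :
    ContinuousAt θhat w' := by
  set C := 1 / (1 - ρ) * Cop with hC
  have hbound : ∀ w'' ∈ weightDomain w ε,
      ‖θhat w'' - θhat w'‖ ≤ C * ‖G g (θhat w') w''‖ := by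
    intro w'' hw''
    have hseg : segment ℝ (θhat w') (θhat w'') ⊆ Ωθ :=
      ((convex_convexHull ℝ _).segment_subset
        (subset_convexHull ℝ _ (Set.mem_image_of_mem θhat hw'))
        (subset_convexHull ℝ _ (Set.mem_image_of_mem θhat hw''))).trans h.convexHull_subset
    have hpd := fun z (hz : z ∈ segment ℝ (θhat w') (θhat w'')) =>
      h.stronglyPosDef hρ hLH hset hw'' (hseg hz)
    have hmono := norm_sub_sq_le_of_stronglyPosDef (F := fun ϑ => G g ϑ w'') (C := C)
      (fun z hz => (contDiffAt_G w'' (h.contDiffAt (hseg hz))).differentiableAt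
        (by exact_mod_cast κ.succ_ne_zero)) hpd
    have hC0 : 0 < C := (hpd _ (left_mem_segment ℝ _ _)).1
    simp only [h.solution w'' hw'', zero_sub] at hmono
    have hcs := real_inner_le_norm (θhat w'' - θhat w') (-G g (θhat w') w'')
    rw [norm_neg] at hcs
    rcases (norm_nonneg (θhat w'' - θhat w')).eq_or_lt with h0 | hpos
    · rw [← h0]
      positivity
    · refine le_of_mul_le_mul_left ?_ hpos
      nlinarith [mul_le_mul_of_nonneg_left hcs hC0.le]
  have hlim : Tendsto (fun w'' => C * ‖G g (θhat w') w''‖) (𝓝 w') (𝓝 0) := by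
    have hc : Continuous fun w'' => C * ‖G g (θhat w') w''‖ :=
      continuous_const.mul (continuous_G_weight g _).norm
    simpa [h.solution w' hw'] using hc.tendsto w'
  rw [ContinuousAt, tendsto_iff_norm_sub_tendsto_zero]
  refine squeeze_zero' (Eventually.of_forall fun _ => norm_nonneg _) ?_ hlim
  filter_upwards [(isOpen_weightDomain w ε).mem_nhds hw'] using hbound

theorem Assumptions.contDiffAt_solution (h : Assumptions κ g w ε Ωθ θhat Cop M δ) (hρ : ρ < 1)
    (hLH : 0 ≤ LH) (hset : Cset Cop LH δ ≤ ρ) {w' : E N} (hw' : w' ∈ weightDomain w ε) :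
    ContDiffAt ℝ ((κ + 1 : ℕ) : WithTop ℕ∞) θhat w' := by
  refine contDiffAt_of_implicit κ.succ_ne_zero (Φ := fun p : E N × E D => G g p.2 p.1)
    (contDiffAt_G_uncurry w' (h.contDiffAt (h.solution_mem hw')))
    (h.continuousAt hρ hLH hset hw') ?_
    (h.stronglyPosDef hρ hLH hset hw' (h.solution_mem hw')).isInvertible
  filter_upwards [(isOpen_weightDomain w ε).mem_nhds hw'] using h.solution

theorem le_deltaMax {k : ℕ} (hk : k ≤ κ + 1) : δ k ≤ deltaMax κ δ :=
  Finset.le_sup' δ (Finset.mem_range.mpr (by omega))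

end Solution

/-! ### Taylor expansion of the solution map -/

theorem norm_thetaIJ_sub_le {N D k : ℕ} {θhat : E N → E D} {w : E N} {R : ℝ}
    (hθ : ∀ t ∈ Set.Icc (0 : ℝ) 1,
      ContDiffAt ℝ ((k + 1 : ℕ) : WithTop ℕ∞) θhat (ones N + t • (w - ones N)))
    (hR : ∀ t ∈ Set.Icc (0 : ℝ) 1, ‖dTheta θhat w (k + 1) (ones N + t • (w - ones N))‖ ≤ R) :
    ‖thetaIJ θhat w k - θhat w‖ ≤ R := by
  have htaylor := map_add_eq_sum_add_integral_iteratedFDeriv (n := k) (f := θhat) (x := ones N)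
    (y := w - ones N) (fun t ht => by exact_mod_cast hθ t ht)
  rw [add_sub_cancel] at htaylor
  have hIJ : thetaIJ θhat w k = ∑ j ∈ Finset.range (k + 1),
      (j.factorial : ℝ)⁻¹ • iteratedFDeriv ℝ j θhat (ones N) (fun _ => w - ones N) := by
    rw [Finset.range_eq_Ico, Finset.sum_eq_sum_Ico_succ_bot (Nat.succ_pos k)]
    simp only [thetaIJ, dTheta, one_div, Nat.factorial_zero, Nat.cast_one, inv_one, one_smul,
      iteratedFDeriv_zero_apply]
    rfl
  rw [htaylor, ← hIJ, sub_add_cancel_left, norm_neg, norm_smul]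
  have hR0 : 0 ≤ R := (norm_nonneg _).trans (hR 0 (by simp))
  have hint : ‖∫ t in (0 : ℝ)..1, (1 - t) ^ k • iteratedFDeriv ℝ (k + 1) θhat
      (ones N + t • (w - ones N)) (fun _ => w - ones N)‖ ≤ R * |1 - 0| := by
    refine intervalIntegral.norm_integral_le_of_norm_le_const fun t ht => ?_
    rw [Set.uIoc_of_le zero_le_one] at ht
    rw [norm_smul, norm_pow, Real.norm_of_nonneg (by linarith [ht.2])]
    calc (1 - t) ^ k * _ ≤ 1 * R := by
          gcongr
          · exact pow_le_one₀ (by linarith [ht.2]) (by linarith [ht.1])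
          · exact hR t ⟨ht.1.le, ht.2⟩
      _ = R := one_mul R
  have hfact : ‖((k.factorial : ℝ)⁻¹)‖ ≤ 1 := by
    rw [norm_inv, Real.norm_natCast]
    exact inv_le_one_of_one_le₀ (by exact_mod_cast k.factorial_pos)
  calc _ ≤ 1 * (R * |1 - 0|) := by gcongr
    _ = R := by simp

end HOIJ

/-- The bounds `O(δ^(k+1))` as `δ → 0`, with a constant `K` and a threshold `δ₀` that depend only
on `κ`, `k`, `C̃_op = C_op / (1 - ρ)` and the `M_j`. The number `L_H ≥ 0` in the smallness condition
is arbitrary, which covers every bound on the variation of the Hessian, such as `M_2`. -/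
theorem mainTheorem1 (κ : ℕ) (Ctilde : ℝ) (M : ℕ → ℝ) (k : ℕ) (hk : k ≤ κ) :
    ∃ K δ₀ : ℝ, 0 < K ∧ 0 < δ₀ ∧
      ∀ (N D : ℕ) (g : Fin (N + 1) → HOIJ.E D → HOIJ.E D) (w : HOIJ.E N) (ε : ℝ)
        (Ωθ : Set (HOIJ.E D)) (θhat : HOIJ.E N → HOIJ.E D) (Cop ρ LH : ℝ) (δ : ℕ → ℝ),
        0 < N →
        HOIJ.Assumptions κ g w ε Ωθ θhat Cop M δ →
        0 < ρ → ρ < 1 → 0 ≤ LH → HOIJ.Cset Cop LH δ ≤ ρ →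
        1 / (1 - ρ) * Cop = Ctilde →
        HOIJ.deltaMax κ δ ≤ δ₀ →
        ContDiffOn ℝ ((κ + 1 : ℕ) : WithTop ℕ∞) θhat (HOIJ.weightDomain w ε) ∧
        (∀ w' ∈ HOIJ.weightDomain w ε,
          ‖HOIJ.dTheta θhat w (k + 1) w'‖ ≤ K * HOIJ.deltaMax κ δ ^ (k + 1)) ∧
        ‖HOIJ.thetaIJ θhat w k - θhat w‖ ≤ K * HOIJ.deltaMax κ δ ^ (k + 1) := by
  -- with `δ ≤ 1`, this bounds the derivatives of `G(·, w')` of orders `1, …, κ + 1`, for all `w'`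
  set C : ℝ := ∑ j ∈ Finset.range (κ + 2), |M j| + 1 with hC
  have hC0 : 0 ≤ C := by positivity
  obtain ⟨B, hB, hmain⟩ :=
    HOIJ.exists_bound_iteratedFDeriv_of_implicit (abs_nonneg Ctilde) hC0 (κ + 1)
  refine ⟨B ^ (k + 1), 1, by positivity, one_pos, ?_⟩
  intro N D g w ε Ωθ θhat Cop ρ LH δ _ h _ hρ hLH hset hCt hδ1
  have hδ0 : 0 ≤ HOIJ.deltaMax κ δ := (h.delta_nonneg (Nat.zero_le _)).trans
    (HOIJ.le_deltaMax (Nat.zero_le _))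
  have hsmooth := fun w' hw' => h.contDiffAt_solution hρ hLH hset (w' := w') hw'
  have hww := HOIJ.mem_weightDomain_self w h.eps_pos
  have hder : ∀ w' ∈ HOIJ.weightDomain w ε,
      ‖HOIJ.dTheta θhat w (k + 1) w'‖ ≤ B ^ (k + 1) * HOIJ.deltaMax κ δ ^ (k + 1) := by
    intro w' hw'
    have hθ := h.solution_mem hw'
    have hf0 : w' + (0 : ℝ) • (w - HOIJ.ones N) = w' := by simp
    have hGc := fun v => HOIJ.contDiffAt_G v (h.contDiffAt hθ)
    -- along the line `s ↦ w' + s (w - 1)` the equation reads `A + s P = 0`, with `A = G(·, w')` and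
    -- `P = G(·, w) - G(·, 1)`, as `G` is affine in the weights
    have hbound := hmain (HOIJ.E D) (fun ϑ => HOIJ.G g ϑ w')
      (fun ϑ => HOIJ.G g ϑ w - HOIJ.G g ϑ (HOIJ.ones N))
      (fun s : ℝ => θhat (w' + s • (w - HOIJ.ones N))) (HOIJ.deltaMax κ δ) hδ0
    simp only [hf0] at hbound
    have hline : ContDiffAt ℝ ((κ + 1 : ℕ) : WithTop ℕ∞)
        (fun s : ℝ => θhat (w' + s • (w - HOIJ.ones N))) 0 :=
      ContDiffAt.comp (0 : ℝ) (by rw [hf0]; exact hsmooth w' hw') (by fun_prop)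
    have hzero : ∀ᶠ s in nhds (0 : ℝ), HOIJ.G g (θhat (w' + s • (w - HOIJ.ones N))) w' +
        s • (HOIJ.G g (θhat (w' + s • (w - HOIJ.ones N))) w -
          HOIJ.G g (θhat (w' + s • (w - HOIJ.ones N))) (HOIJ.ones N)) = 0 := by
      have hcont : ContinuousAt (fun s : ℝ => w' + s • (w - HOIJ.ones N)) 0 := by fun_prop
      have hmem := hcont.eventually (p := (· ∈ HOIJ.weightDomain w ε))
        ((HOIJ.isOpen_weightDomain w ε).mem_nhds (by simpa using hw'))
      filter_upwards [hmem] with s hs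
      rw [← HOIJ.G_add_smul_sub]
      exact h.solution _ hs
    have hA : ∀ i, 1 ≤ i → i ≤ κ + 1 →
        ‖iteratedFDeriv ℝ i (fun ϑ => HOIJ.G g ϑ w') (θhat w')‖ ≤ C := by
      intro i hi1 hi
      have h1 := (HOIJ.norm_iteratedFDeriv_G_le g i _ _).trans (h.bounded i hi1 hi _ hθ)
      have h2 := (HOIJ.norm_iteratedFDeriv_G_sub_le g i _ _ _).trans
        (h.complexity i hi w' hw' _ hθ)
      have h3 : δ i ≤ 1 := (HOIJ.le_deltaMax hi).trans hδ1
      have h4 : |M i| ≤ ∑ j ∈ Finset.range (κ + 2), |M j| :=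
        Finset.single_le_sum (f := fun j => |M j|) (fun _ _ => abs_nonneg _)
          (Finset.mem_range.mpr (by omega))
      have h5 := norm_le_norm_add_norm_sub (iteratedFDeriv ℝ i (fun ϑ => HOIJ.G g ϑ (HOIJ.ones N))
        (θhat w')) (iteratedFDeriv ℝ i (fun ϑ => HOIJ.G g ϑ w') (θhat w'))
      rw [norm_sub_rev] at h5
      linarith [le_abs_self (M i)]
    have hP : ∀ i, i ≤ κ + 1 → ‖iteratedFDeriv ℝ i
        (fun ϑ => HOIJ.G g ϑ w - HOIJ.G g ϑ (HOIJ.ones N)) (θhat w')‖ ≤ HOIJ.deltaMax κ δ := by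
      intro i hi
      have hi' : (i : WithTop ℕ∞) ≤ ((κ + 1 : ℕ) : WithTop ℕ∞) := by exact_mod_cast hi
      change ‖iteratedFDeriv ℝ i
        ((fun ϑ => HOIJ.G g ϑ w) - fun ϑ => HOIJ.G g ϑ (HOIJ.ones N)) (θhat w')‖ ≤ _
      rw [iteratedFDeriv_sub_apply ((hGc w).of_le hi') ((hGc _).of_le hi')]
      exact ((HOIJ.norm_iteratedFDeriv_G_sub_le g i _ _ _).trans
        (h.complexity i hi w hww _ hθ)).trans (HOIJ.le_deltaMax hi)
    have hinv : ∀ v, ‖v‖ ≤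
        |Ctilde| * ‖fderiv ℝ (fun ϑ => HOIJ.G g ϑ w') (θhat w') v‖ := by
      intro v
      have hpd := h.stronglyPosDef hρ hLH hset hw' hθ
      rw [hCt] at hpd
      exact (hpd.norm_le v).trans (by gcongr; exact le_abs_self _)
    have hfin := hbound (hGc w') ((hGc w).sub (hGc _)) hline hzero hinv hA hP (k + 1)
      (by omega) (by omega)
    rw [norm_iteratedFDeriv_eq_norm_iteratedDeriv, HOIJ.iteratedDeriv_comp_line, hf0,
      mul_pow] at hfin
    · exact hfin
    · rw [hf0]
      exact (hsmooth w' hw').of_le (by exact_mod_cast Nat.succ_le_succ hk)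
  refine ⟨fun w' hw' => (hsmooth w' hw').contDiffWithinAt, hder, ?_⟩
  refine HOIJ.norm_thetaIJ_sub_le (fun t ht => ?_) fun t ht =>
    hder _ (HOIJ.segment_mem_weightDomain w h.eps_pos ht)
  exact (hsmooth _ (HOIJ.segment_mem_weightDomain w h.eps_pos ht)).of_le
    (by exact_mod_cast Nat.succ_le_succ hk)
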